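/- For a finite group $G$, let $I\subseteq\mathbb{Z}[G]$ be the Scharlau ideal of $G$, that is, the two-sided ideal generated by the elements $\sum_{h\in H}h$, where $H$ ranges over the nontrivial subgroups of $G$. The Scharlau invariant of $G$ is the nonnegative generator of the ideal $I\cap\mathbb{Z}$ of $\mathbb{Z}$, where $\mathbb{Z}$ is identified with $\mathbb{Z}\cdot 1\subseteq\mathbb{Z}[G]$. Corollary. Let $p\ge 17$ be a Fermat prime, i.e. a prime of the form $p=2^{2^k}+1$. Then the Scharlau invariant of $\mathrm{SL}_2(\mathbb{F}_p)$ is exactly $p$. -/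

import Mathlib

noncomputable section

/-- For a subset `S` of a finite group `G`, the element of the integral group ring `ℤ[G]`
which is the sum of the elements of `S`. -/
def groupRingSum {G : Type*} [Group G] [Finite G] (S : Set G) : MonoidAlgebra ℤ G :=
  ∑ᶠ g ∈ S, MonoidAlgebra.of ℤ G g

/-- The Scharlau ideal of a finite group `G`: the two-sided ideal of `ℤ[G]` generated by the sums
of the elements of `H`, for `H` ranging over the nontrivial subgroups of `G`. -/
def scharlauIdeal (G : Type*) [Group G] [Finite G] : TwoSidedIdeal (MonoidAlgebra ℤ G) :=
  TwoSidedIdeal.span {x | ∃ H : Subgroup G, H ≠ ⊥ ∧ x = groupRingSum (H : Set G)}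

/-- The intersection of the Scharlau ideal with `ℤ = ℤ · 1 ⊆ ℤ[G]`, as an ideal of `ℤ`. -/
def scharlauIntIdeal (G : Type*) [Group G] [Finite G] : Ideal ℤ :=
  TwoSidedIdeal.asIdeal
    (TwoSidedIdeal.comap (Int.castRingHom (MonoidAlgebra ℤ G)) (scharlauIdeal G))

/-- The Scharlau invariant of a finite group `G`: the nonnegative generator of the intersection
of the Scharlau ideal with `ℤ`. -/
def scharlauInvariant (G : Type*) [Group G] [Finite G] : ℕ :=
  (Submodule.IsPrincipal.generator (scharlauIntIdeal G)).natAbs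

theorem mem_scharlauIntIdeal {G : Type*} [Group G] [Finite G] (n : ℤ) :
    n ∈ scharlauIntIdeal G ↔ (n : MonoidAlgebra ℤ G) ∈ scharlauIdeal G := by
  simp [scharlauIntIdeal, TwoSidedIdeal.mem_asIdeal, TwoSidedIdeal.mem_comap]

/-- The Scharlau invariant is the unique natural number that generates the intersection. -/
theorem scharlauInvariant_eq_iff {G : Type*} [Group G] [Finite G] (n : ℕ) :
    scharlauInvariant G = n ↔ Ideal.span {(n : ℤ)} = scharlauIntIdeal G := by
  have h : Ideal.span {(scharlauInvariant G : ℤ)} = scharlauIntIdeal G := by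
    rw [scharlauInvariant, Int.span_natAbs]
    exact Ideal.span_singleton_generator _
  rw [← h, Ideal.span_singleton_eq_span_singleton, Int.associated_iff_natAbs]
  simp [eq_comm]

end

/-!
Let `G = SL₂(𝔽_p)` and let `R` be the quotient of `ℤ[G]` by the Scharlau ideal.

*The prime `p` vanishes in `R`.* Write `u = !![1, 1; 0, 1]` and `w = !![0, 1; -1, 0]`. In `R` the
central involution `-1` of `G` becomes the scalar `-1`, and since `w * u` has order three,
`1 + w u - u⁻¹ w = 0`. This relation makes `z = u + u⁻¹` commute with `w`, so `z` commutes with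
every word in `u` and `w` (`commute_add_of_relation`). One such word is `t = diag(2, 2⁻¹)`, for
which `t u t⁻¹ = u⁴`. Hence `u + u⁻¹ = u⁴ + u⁻⁴`, that is, `(u⁵ - 1) (u³ - 1) = 0`. As `u` has order
`p`, which is prime to `3` and `5`, `u - 1` is a multiple of both `u⁵ - 1` and `u³ - 1`, so
`(u - 1)² = 0`. Together with `∑ i < p, uⁱ = 0` this forces `p = 0`
(`natCast_eq_zero_of_sub_one_sq_eq_zero`).

*No integer prime to `p` lies in the ideal.* The tautological ring homomorphism
`ℤ[G] → M₂(𝔽_p)` kills the Scharlau ideal: if `g ≠ 1` has trace different from `2`, then `g - 1` is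
invertible, and otherwise `g` is unipotent of order `p`; in both cases the sum of the powers of `g`
vanishes. An integer in the ideal therefore vanishes in `M₂(𝔽_p)`.

Both halves use that a ring homomorphism kills the Scharlau ideal exactly when it kills the sums
over the nontrivial cyclic subgroups (`scharlauIdeal_le_ker_iff`).
-/

/-! ### Sums over subgroups -/

theorem finsum_mem_zpowers_eq_sum_range {G M : Type*} [Group G] [Finite G] [AddCommMonoid M]
    (f : G → M) (g : G) :
    ∑ᶠ x ∈ (Subgroup.zpowers g : Set G), f x = ∑ i ∈ Finset.range (orderOf g), f (g ^ i) := by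
  rw [← finsum_set_coe_eq_finsum_mem]
  refine (finsum_comp_equiv (finEquivZPowers (isOfFinOrder_of_finite g))).symm.trans ?_
  rw [finsum_eq_sum_of_fintype, Finset.sum_range]
  rfl

/-- If the values of a multiplicative map sum to zero over a cyclic subgroup, then they sum to zero
over the whole group, which is a union of left cosets of that subgroup. -/
theorem finsum_eq_zero_of_sum_range_orderOf_eq_zero {G R : Type*} [Group G] [Finite G]
    [Semiring R] (f : G →* R) (g : G) (h : ∑ i ∈ Finset.range (orderOf g), f g ^ i = 0) :
    ∑ᶠ x, f x = 0 := by
  classical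
  have := Fintype.ofFinite G
  let K := Subgroup.zpowers g
  have hK : ∑ k : K, f k = 0 := by
    rw [← finsum_eq_sum_of_fintype]
    refine (finsum_set_coe_eq_finsum_mem (f := f) (K : Set G)).trans ?_
    rw [finsum_mem_zpowers_eq_sum_range]
    simpa using h
  obtain ⟨S, hS, -⟩ := K.exists_isComplement_left 1
  rw [finsum_eq_sum_of_fintype, ← Function.Bijective.sum_comp hS, Fintype.sum_prod_type]
  refine Finset.sum_eq_zero fun s _ => ?_
  simp_rw [map_mul, ← Finset.mul_sum]
  exact (congrArg _ hK).trans (mul_zero _)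

theorem map_groupRingSum {G R : Type*} [Group G] [Finite G] [Ring R]
    (F : MonoidAlgebra ℤ G →+* R) (S : Set G) :
    F (groupRingSum S) = ∑ᶠ g ∈ S, F (MonoidAlgebra.of ℤ G g) :=
  F.toAddMonoidHom.map_finsum_mem _ S.toFinite

theorem scharlauIdeal_le_ker_iff {G R : Type*} [Group G] [Finite G] [Ring R]
    (F : MonoidAlgebra ℤ G →+* R) :
    scharlauIdeal G ≤ TwoSidedIdeal.ker F ↔
      ∀ g : G, g ≠ 1 → ∑ i ∈ Finset.range (orderOf g), F (MonoidAlgebra.of ℤ G g) ^ i = 0 := by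
  rw [scharlauIdeal, TwoSidedIdeal.span_le]
  constructor
  · intro h g hg
    have := h ⟨Subgroup.zpowers g, by simpa using hg, rfl⟩
    rw [SetLike.mem_coe, TwoSidedIdeal.mem_ker, map_groupRingSum,
      finsum_mem_zpowers_eq_sum_range] at this
    simpa only [map_pow] using this
  · rintro h x ⟨H, hH, rfl⟩
    obtain ⟨g, hg⟩ := Subgroup.ne_bot_iff_exists_ne_one.1 hH
    rw [SetLike.mem_coe, TwoSidedIdeal.mem_ker, map_groupRingSum,
      ← finsum_set_coe_eq_finsum_mem (H : Set G)]
    refine finsum_eq_zero_of_sum_range_orderOf_eq_zero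
      (((F : MonoidAlgebra ℤ G →* R).comp (MonoidAlgebra.of ℤ G)).comp H.subtype) g ?_
    simpa using h g (by simpa using hg)

/-! ### Relations forcing a prime to vanish in a ring -/

section Ring

variable {R : Type*} [Ring R]

/-- For `v = u⁻¹`, the relation `1 + w u - u⁻¹ w = 0` makes `u + u⁻¹` commute with `w`. -/
theorem commute_add_of_relation {u v w : R} (huv : u * v = 1)
    (h : 1 + w * u - v * w = 0) : Commute (u + v) w := by
  have h1 : v * w = 1 + w * u := (sub_eq_zero.1 h).symm
  -- Multiplying the relation by `u` on the left and by `v = u⁻¹` on the right.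
  have h2 : u * w = w * v - 1 := by
    have : u * (1 + w * u - v * w) * v = 0 := by rw [h]; simp
    have e : u * (1 + w * u - v * w) * v =
        u * v + u * w * (u * v) - (u * v) * w * v := by noncomm_ring
    rw [e, huv] at this
    simp only [mul_one, one_mul] at this
    rw [← sub_eq_zero, ← this]
    abel
  rw [Commute, SemiconjBy, add_mul, mul_add, h1, h2]
  abel

/-- A power of `uᵏ` equals `u`, so `u - 1` is a geometric sum in `uᵏ` times `uᵏ - 1`. -/
theorem sub_one_dvd_pow_sub_one_of_pow_eq_one {u : R} {p k : ℕ} (hp : 1 < p) (hu : u ^ p = 1)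
    (hk : k.Coprime p) : ∃ q, u - 1 = q * (u ^ k - 1) ∧ Commute q u := by
  obtain ⟨m, hm⟩ := Nat.exists_mul_mod_eq_one_of_coprime hk hp
  refine ⟨∑ i ∈ Finset.range m, (u ^ k) ^ i, ?_, ?_⟩
  · rw [geom_sum_mul, ← pow_mul, ← Nat.mod_add_div (k * m) p, hm.2, pow_add, pow_mul, hu]
    simp
  · exact Commute.sum_left _ _ _ fun i _ => ((Commute.refl u).pow_left k).pow_left i

/-- The identity `u + u⁻¹ = u⁴ + u⁻⁴` amounts to `(u⁵ - 1) (u³ - 1) = 0`; for `u` of order prime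
to `3` and `5` it makes `u` unipotent. -/
theorem sub_one_sq_eq_zero_of_add_eq {u v : R} {p : ℕ} (hp : 1 < p) (hu : u ^ p = 1)
    (h3 : Nat.Coprime 3 p) (h5 : Nat.Coprime 5 p) (hvu : v * u = 1)
    (h : u + v = u ^ 4 + v ^ 4) : (u - 1) ^ 2 = 0 := by
  obtain ⟨a, ha, -⟩ := sub_one_dvd_pow_sub_one_of_pow_eq_one hp hu h5
  obtain ⟨b, hb, hbu⟩ := sub_one_dvd_pow_sub_one_of_pow_eq_one hp hu h3
  have h0 : (u ^ 5 - 1) * (u ^ 3 - 1) = 0 := by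
    have e1 : v ^ 4 * u ^ 4 = 1 := by
      simp only [pow_succ, pow_zero, one_mul, mul_assoc]
      simp [hvu, ← mul_assoc v u]
    have e2 : (u + v) * u ^ 4 = u ^ 5 + u ^ 3 := by
      rw [add_mul, ← pow_succ', pow_succ' u 3, ← mul_assoc v, hvu, one_mul]
    have e3 : (u ^ 4 + v ^ 4) * u ^ 4 = u ^ 8 + 1 := by rw [add_mul, e1, ← pow_add]
    rw [h, e3] at e2
    have : (u ^ 5 - 1) * (u ^ 3 - 1) = (u ^ 8 + 1) - (u ^ 5 + u ^ 3) := by noncomm_ring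
    rw [this, e2, sub_self]
  have hc : Commute b (u ^ 5 - 1) := (hbu.pow_right 5).sub_right (Commute.one_right b)
  calc (u - 1) ^ 2 = a * ((u ^ 5 - 1) * b) * (u ^ 3 - 1) := by
        rw [sq]; nth_rewrite 1 [ha]; rw [hb]; noncomm_ring
    _ = a * b * ((u ^ 5 - 1) * (u ^ 3 - 1)) := by rw [← hc.eq]; noncomm_ring
    _ = 0 := by rw [h0, mul_zero]

theorem pow_eq_one_add_of_sub_one_sq_eq_zero {u : R} (h : (u - 1) ^ 2 = 0) (n : ℕ) :
    u ^ n = 1 + n * (u - 1) := by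
  induction n with
  | zero => simp
  | succ n ih =>
    have e : (1 + (n : R) * (u - 1)) * u = 1 + (n + 1) * (u - 1) + n * (u - 1) ^ 2 := by
      noncomm_ring
    rw [pow_succ, ih, e, h, mul_zero, add_zero, Nat.cast_succ]

theorem sum_range_pow_of_sub_one_sq_eq_zero {u : R} (h : (u - 1) ^ 2 = 0) {p : ℕ} (hp : Odd p) :
    ∑ i ∈ Finset.range p, u ^ i = p * u ^ ((p - 1) / 2) := by
  have e : ∑ i ∈ Finset.range p, i = p * ((p - 1) / 2) := by
    rw [Finset.sum_range_id, Nat.mul_div_assoc _ (hp.tsub_odd odd_one).two_dvd]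
  simp_rw [pow_eq_one_add_of_sub_one_sq_eq_zero h, Finset.sum_add_distrib, ← Finset.sum_mul]
  rw [← Nat.cast_sum, e]
  simp [mul_add, mul_assoc]

theorem natCast_eq_zero_of_sub_one_sq_eq_zero {u v : R} (h : (u - 1) ^ 2 = 0) (huv : u * v = 1)
    (hvu : v * u = 1) {p : ℕ} (hp : Odd p) (hs : ∑ i ∈ Finset.range p, u ^ i = 0) :
    (p : R) = 0 := by
  rw [sum_range_pow_of_sub_one_sq_eq_zero h hp] at hs
  have hu : IsUnit u := ⟨⟨u, v, huv, hvu⟩, rfl⟩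
  exact (hu.pow ((p - 1) / 2)).mul_left_eq_zero.1 hs

end Ring

/-! ### Elements of the special linear group -/

namespace Matrix.SpecialLinearGroup

/-- The unipotent matrix `!![1, 1; 0, 1]`. -/
def upper (A : Type*) [CommRing A] : SpecialLinearGroup (Fin 2) A :=
  ⟨!![1, 1; 0, 1], by simp⟩

/-- The Weyl element `!![0, 1; -1, 0]`. -/
def weyl (A : Type*) [CommRing A] : SpecialLinearGroup (Fin 2) A :=
  ⟨!![0, 1; -1, 0], by simp⟩

section

variable {A : Type*} [CommRing A]

theorem coe_upper_pow (n : ℕ) :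
    ((upper A ^ n : SpecialLinearGroup (Fin 2) A) : Matrix (Fin 2) (Fin 2) A) =
      !![1, (n : A); 0, 1] := by
  induction n with
  | zero => simp [Matrix.one_fin_two]
  | succ n ih =>
    rw [pow_succ, coe_mul, ih]
    simp [upper, add_comm]

theorem coe_upper : (upper A : Matrix (Fin 2) (Fin 2) A) = !![1, 1; 0, 1] := rfl

theorem coe_weyl : (weyl A : Matrix (Fin 2) (Fin 2) A) = !![0, 1; -1, 0] := rfl

theorem weyl_mul_upper_pow_three : (weyl A * upper A) ^ 3 = 1 := by
  apply Subtype.ext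
  simp only [coe_pow, coe_mul, coe_weyl, coe_upper, coe_one]
  ext i j
  fin_cases i <;> fin_cases j <;> simp [pow_succ]

theorem weyl_mul_upper_sq : upper A * (weyl A * upper A) ^ 2 = -1 * weyl A := by
  apply Subtype.ext
  simp only [coe_pow, coe_mul, coe_neg, coe_weyl, coe_upper, coe_one]
  ext i j
  fin_cases i <;> fin_cases j <;> simp [pow_succ]

/-- If `2 n = 1` in `A`, the word `u² w uⁿ w u² w` is `diag(2, n)`, and it conjugates `u` to
`u⁴`. -/
theorem word_mul_upper {n : ℕ} (hn : (2 * n : A) = 1) :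
    (upper A ^ 2 * weyl A * upper A ^ n * weyl A * upper A ^ 2 * weyl A) * upper A =
      upper A ^ 4 * (upper A ^ 2 * weyl A * upper A ^ n * weyl A * upper A ^ 2 * weyl A) := by
  apply Subtype.ext
  simp only [coe_mul, coe_upper_pow, coe_weyl, coe_upper]
  ext i j
  fin_cases i <;> fin_cases j <;> simp <;> grind

theorem upper_ne_one [Nontrivial A] : upper A ≠ 1 := by
  intro h
  have := congrArg (fun g : SpecialLinearGroup (Fin 2) A => g 0 1) h
  simp [upper] at this

theorem weyl_mul_upper_ne_one [Nontrivial A] : weyl A * upper A ≠ 1 := by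
  intro h
  have := congrFun (congrFun (congrArg Subtype.val h) 0) 1
  rw [coe_mul, coe_weyl, coe_upper] at this
  simp at this

theorem upper_pow_char (p : ℕ) [CharP A p] : upper A ^ p = 1 := by
  apply Subtype.ext
  rw [coe_upper_pow]
  simp [Matrix.one_fin_two]

/-- By Cayley–Hamilton, `(g - 1)² = (tr g - 2) g` for `g` of determinant one, and
`2 - tr g = det (g - 1)`. -/
theorem sub_one_sq_eq_zero (g : SpecialLinearGroup (Fin 2) A)
    (h : ((g : Matrix (Fin 2) (Fin 2) A) - 1).det = 0) :
    ((g : Matrix (Fin 2) (Fin 2) A) - 1) ^ 2 = 0 := by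
  have hd := g.det_coe
  rw [Matrix.det_fin_two] at h hd
  simp only [Matrix.sub_apply, Matrix.one_apply_eq, ne_eq, zero_ne_one, one_ne_zero,
    not_false_eq_true, Matrix.one_apply_ne, sub_zero] at h
  ext i j
  fin_cases i <;> fin_cases j <;> simp [sq, Matrix.mul_apply] <;> grind

end

end Matrix.SpecialLinearGroup

open Matrix.SpecialLinearGroup

/-! ### The Scharlau ideal of the special linear group -/

variable (p : ℕ) [Fact p.Prime]

theorem natCast_mem_scharlauIdeal (hp : 7 ≤ p) :
    ((p : ℤ) : MonoidAlgebra ℤ (Matrix.SpecialLinearGroup (Fin 2) (ZMod p))) ∈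
      scharlauIdeal (Matrix.SpecialLinearGroup (Fin 2) (ZMod p)) := by
  have hpp : p.Prime := Fact.out
  have hodd : Odd p := hpp.odd_of_ne_two (by omega)
  set I := scharlauIdeal (Matrix.SpecialLinearGroup (Fin 2) (ZMod p))
  let F := I.ringCon.mk'
  have hF : TwoSidedIdeal.ker F = I := TwoSidedIdeal.ker_ringCon_mk' I
  have hsum := (scharlauIdeal_le_ker_iff F).1 hF.ge
  rw [← hF, TwoSidedIdeal.mem_ker, map_intCast, Int.cast_natCast]
  let f : Matrix.SpecialLinearGroup (Fin 2) (ZMod p) →* I.ringCon.Quotient :=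
    (F : _ →* I.ringCon.Quotient).comp (MonoidAlgebra.of ℤ _)
  replace hsum : ∀ g, g ≠ 1 → ∑ i ∈ Finset.range (orderOf g), f g ^ i = 0 := hsum
  have : Fact (2 < p) := ⟨by omega⟩
  have hneg1 : (-1 : Matrix.SpecialLinearGroup (Fin 2) (ZMod p)) ≠ 1 := by
    intro h
    have := congrArg (fun g : Matrix.SpecialLinearGroup (Fin 2) (ZMod p) => g 0 0) h
    simp [ZMod.neg_one_ne_one] at this
  have hneg : f (-1) = -1 := by
    have h := hsum (-1) hneg1
    rw [orderOf_eq_prime (p := 2) (by simp) hneg1] at h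
    simp [Finset.sum_range_succ] at h
    exact (neg_eq_of_add_eq_zero_right h).symm
  set u := upper (ZMod p)
  set w := weyl (ZMod p)
  have huv : f u * f u⁻¹ = 1 := by rw [← map_mul]; simp
  have hvu : f u⁻¹ * f u = 1 := by rw [← map_mul]; simp
  have hrel : 1 + f w * f u - f u⁻¹ * f w = 0 := by
    have h := hsum (w * u) weyl_mul_upper_ne_one
    rw [orderOf_eq_prime (p := 3) weyl_mul_upper_pow_three weyl_mul_upper_ne_one] at h
    have h2 : f (w * u) ^ 2 = - (f u⁻¹ * f w) := by
      rw [← map_pow, show (w * u) ^ 2 = u⁻¹ * (-1 * w) by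
        rw [← weyl_mul_upper_sq, inv_mul_cancel_left], map_mul, map_mul, hneg]
      simp
    rw [Finset.sum_range_succ, h2] at h
    simpa [Finset.sum_range_succ, sub_eq_add_neg] using h
  have hzw : Commute (f u + f u⁻¹) (f w) := commute_add_of_relation huv hrel
  have hzu : Commute (f u + f u⁻¹) (f u) :=
    (Commute.refl _).add_left (by rw [Commute, SemiconjBy, huv, hvu])
  obtain ⟨m, hm⟩ := hodd
  -- `m + 1 = (p + 1) / 2` is an inverse of `2` modulo `p`.
  have hn : (2 * ((m + 1 : ℕ) : ZMod p) : ZMod p) = 1 := by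
    have : (2 * m + 1 : ZMod p) = 0 := by simpa using congrArg (Nat.cast (R := ZMod p)) hm.symm
    push_cast
    linear_combination this
  have hword := word_mul_upper hn
  set t := u ^ 2 * w * u ^ (m + 1) * w * u ^ 2 * w with ht
  have hzt : Commute (f u + f u⁻¹) (f t) := by
    simp only [ht, map_mul, map_pow]
    exact (((((hzu.pow_right 2).mul_right hzw).mul_right (hzu.pow_right _)).mul_right
      hzw).mul_right (hzu.pow_right 2)).mul_right hzw
  have hconj : f t * f u = f u ^ 4 * f t := by
    rw [← map_mul, ← map_pow, ← map_mul]
    exact congrArg f hword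
  have hconj' : f t * f u⁻¹ = f u⁻¹ ^ 4 * f t := by
    rw [← map_mul, ← map_pow, ← map_mul]
    refine congrArg f ?_
    rw [inv_pow, eq_inv_mul_iff_mul_eq, ← mul_assoc, ← hword, mul_inv_cancel_right]
  have hz : f u + f u⁻¹ = f u ^ 4 + f u⁻¹ ^ 4 := by
    have h : (f u + f u⁻¹) * f t = (f u ^ 4 + f u⁻¹ ^ 4) * f t := by
      rw [hzt.eq, mul_add, hconj, hconj', add_mul]
    exact ((Group.isUnit t).map f).mul_right_cancel h
  have hup : u ^ p = 1 := upper_pow_char p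
  have h3 : Nat.Coprime 3 p := (Nat.coprime_primes Nat.prime_three hpp).2 (by omega)
  have h5 : Nat.Coprime 5 p := (Nat.coprime_primes Nat.prime_five hpp).2 (by omega)
  have hsq := sub_one_sq_eq_zero_of_add_eq hpp.one_lt (by rw [← map_pow, hup, map_one]) h3 h5
    hvu hz
  refine natCast_eq_zero_of_sub_one_sq_eq_zero hsq huv hvu ⟨m, hm⟩ ?_
  have h := hsum u upper_ne_one
  rwa [orderOf_eq_prime hup upper_ne_one] at h

theorem sum_range_orderOf_coe_pow_eq_zero (hp : p ≠ 2)
    (g : Matrix.SpecialLinearGroup (Fin 2) (ZMod p)) (hg : g ≠ 1) :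
    ∑ i ∈ Finset.range (orderOf g), (g : Matrix (Fin 2) (Fin 2) (ZMod p)) ^ i = 0 := by
  by_cases hd : ((g : Matrix (Fin 2) (Fin 2) (ZMod p)) - 1).det = 0
  · have hsq := sub_one_sq_eq_zero g hd
    have hgp : g ^ p = 1 := by
      apply Subtype.ext
      rw [coe_pow, pow_eq_one_add_of_sub_one_sq_eq_zero hsq]
      simp
    rw [orderOf_eq_prime hgp hg, sum_range_pow_of_sub_one_sq_eq_zero hsq
      ((Fact.out : p.Prime).odd_of_ne_two hp)]
    simp
  · have hu : IsUnit ((g : Matrix (Fin 2) (Fin 2) (ZMod p)) - 1) :=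
      (Matrix.isUnit_iff_isUnit_det _).2 (isUnit_iff_ne_zero.2 hd)
    refine hu.mul_left_eq_zero.1 ?_
    rw [geom_sum_mul, ← coe_pow, pow_orderOf_eq_one, coe_one, sub_self]

theorem dvd_of_intCast_mem_scharlauIdeal (hp : p ≠ 2) {n : ℤ}
    (hn : (n : MonoidAlgebra ℤ (Matrix.SpecialLinearGroup (Fin 2) (ZMod p))) ∈
      scharlauIdeal (Matrix.SpecialLinearGroup (Fin 2) (ZMod p))) : (p : ℤ) ∣ n := by
  let F : MonoidAlgebra ℤ (Matrix.SpecialLinearGroup (Fin 2) (ZMod p)) →+*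
      Matrix (Fin 2) (Fin 2) (ZMod p) :=
    (MonoidAlgebra.lift ℤ _ _ coeMonoidHom).toRingHom
  have hF : scharlauIdeal _ ≤ TwoSidedIdeal.ker F := by
    refine (scharlauIdeal_le_ker_iff F).2 fun g hg => ?_
    have : F (MonoidAlgebra.of ℤ _ g) = (g : Matrix (Fin 2) (Fin 2) (ZMod p)) := by
      simp [F]
    rw [this, sum_range_orderOf_coe_pow_eq_zero p hp g hg]
  have h := hF hn
  rw [TwoSidedIdeal.mem_ker, map_intCast] at h
  have h00 := congrFun (congrFun h 0) 0
  rw [← ZMod.intCast_zmod_eq_zero_iff_dvd]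
  simpa [← Matrix.diagonal_intCast] using h00

theorem mainTheorem2 (p : ℕ) [Fact p.Prime] (hF : ∃ k : ℕ, p = Nat.fermatNumber k)
    (hp : 17 ≤ p) :
    scharlauInvariant (Matrix.SpecialLinearGroup (Fin 2) (ZMod p)) = p := by
  rw [scharlauInvariant_eq_iff]
  apply le_antisymm
  · rw [Ideal.span_singleton_le_iff_mem, mem_scharlauIntIdeal]
    exact natCast_mem_scharlauIdeal p (by omega)
  · intro n hn
    rw [mem_scharlauIntIdeal] at hn
    exact Ideal.mem_span_singleton.2 (dvd_of_intCast_mem_scharlauIdeal p (by omega) hn)
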